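/- Let $d\ge 0$ and $n_1,\dots,n_d\ge 0$ be integers, and let $S\subseteq [n_1]\times\cdots\times[n_d]$ be any set of positions (a pattern). A partial tensor subordinate to $S$ is a real $n_1\times\cdots\times n_d$ tensor of which exactly the entries in the positions of $S$ are specified, that is, a point $M=(m_s)_{s\in S}\in\mathbb{R}^S$. Then the set of all $M\in\mathbb{R}^S$ for which there is a real tensor $T=(t_i)$ of format $n_1\times\cdots\times n_d$ such that * $t_i\ge 0$ for all $i$ and $\sum_i t_i=1$ ($T$ lies in the standard simplex), * $T$ has rank one, i.e. $T\neq 0$ and $T=u^1\otimes\cdots\otimes u^d$ for some real vectors $u^k\in\mathbb{R}^{n_k}$, * $t_s=m_s$ for all $s\in S$ ($T$ completes $M$), is a semialgebraic subset of $\mathbb{R}^S$, that is, it is obtained by finitely many unions, intersections and complements from sets of the form $\{p=0\}$ and $\{p>0\}$, where $p$ is a polynomial with real coefficients in the coordinates of $\mathbb{R}^S$. -/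

import Mathlib

/-- A real tensor of order `d` and format `n 0 × n 1 × ⋯ × n (d - 1)`, given by its entries.
For `d = 2` this is an `n 0 × n 1` matrix. -/
abbrev RealTensor {d : ℕ} (n : Fin d → ℕ) : Type :=
  (∀ k : Fin d, Fin (n k)) → ℝ

/-- A partial tensor subordinate to the pattern `S`, i.e. whose set of positions of specified
entries is exactly `S`: it is the family of its specified entries, a point of `ℝ^S`. -/
abbrev PartialTensor {d : ℕ} {n : Fin d → ℕ} (S : Set (∀ k : Fin d, Fin (n k))) : Type :=
  S → ℝ

/-- A tensor has rank one if it is nonzero and it is an outer product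
`u 0 ⊗ u 1 ⊗ ⋯ ⊗ u (d - 1)` of real vectors. -/
def RealTensor.IsRankOne {d : ℕ} {n : Fin d → ℕ} (T : RealTensor n) : Prop :=
  T ≠ 0 ∧ ∃ u : ∀ k : Fin d, Fin (n k) → ℝ, ∀ i, T i = ∏ k, u k (i k)

/-- `T` is a completion of the partial tensor `M`: it has the specified entries of `M`. -/
def PartialTensor.IsCompletion {d : ℕ} {n : Fin d → ℕ} {S : Set (∀ k : Fin d, Fin (n k))}
    (M : PartialTensor S) (T : RealTensor n) : Prop :=
  ∀ s : S, T s = M s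

/-- The partial tensor `M` can be completed to a rank-one tensor in the standard simplex, i.e.
to a rank-one tensor whose entries are nonnegative and sum to one. -/
def PartialTensor.IsCompletable {d : ℕ} {n : Fin d → ℕ} {S : Set (∀ k : Fin d, Fin (n k))}
    (M : PartialTensor S) : Prop :=
  ∃ T : RealTensor n, T ∈ stdSimplex ℝ (∀ k : Fin d, Fin (n k)) ∧ T.IsRankOne ∧ M.IsCompletion T

/-- Semialgebraic subsets of `ℝ^ι` (`ι` finite): the smallest class of subsets that contains all
solution sets of polynomial equations `p = 0` and strict polynomial inequalities `p > 0` with real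
coefficients and is closed under finite unions, finite intersections and complements. -/
inductive IsSemialgebraic {ι : Type} : Set (ι → ℝ) → Prop
  | eq_zero (p : MvPolynomial ι ℝ) : IsSemialgebraic {x | MvPolynomial.eval x p = 0}
  | pos (p : MvPolynomial ι ℝ) : IsSemialgebraic {x | 0 < MvPolynomial.eval x p}
  | union {A B : Set (ι → ℝ)} : IsSemialgebraic A → IsSemialgebraic B → IsSemialgebraic (A ∪ B)
  | inter {A B : Set (ι → ℝ)} : IsSemialgebraic A → IsSemialgebraic B → IsSemialgebraic (A ∩ B)
  | compl {A : Set (ι → ℝ)} : IsSemialgebraic A → IsSemialgebraic Aᶜ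

/-! A nonnegative rank-one tensor of total sum one is an outer product of probability vectors: take
absolute values of the factors and normalise. Hence the set of completable `M` is the projection,
along a unit cube, of a set cut out by polynomial equations, and what is needed is Tarski–Seidenberg
for one variable ranging over `[0, 1]`, applied once per coordinate.

That elimination is `exists_mem_Icc`. A definable condition on `t` depends only on the signs of
finitely many polynomials, which are constant between consecutive nodes (`IsNode`, `IsGap`), so it
suffices to test the nodes and the midpoints of the gaps. Quantifying over nodes means quantifying
over roots, which `rootElimination` does by induction on the degree: pseudo-division by `P` lowers
the degree of the condition, and between nodes that include the roots of `P'`, a root of `P` is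
detected by a sign change.

Coefficients lie in an arbitrary ring `R` evaluated at parameters, so that adjoining a variable just
replaces `R` by `R[X]`. -/

/-! ### Boolean combinations of sign conditions -/

/-- Predicates on `X` that are Boolean combinations of sign conditions `0 < r`, where the elements
`r` of the ring `R` are read as real functions on `X` through `ev`. -/
inductive SignDefinable {X R : Type*} [CommRing R] (ev : X → R →+* ℝ) : (X → Prop) → Prop
  | pos (r : R) : SignDefinable ev fun x => 0 < ev x r
  | not {A : X → Prop} : SignDefinable ev A → SignDefinable ev fun x => ¬ A x
  | and {A B : X → Prop} : SignDefinable ev A → SignDefinable ev B →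
      SignDefinable ev fun x => A x ∧ B x

namespace SignDefinable

variable {X Y R R' : Type*} [CommRing R] [CommRing R'] {ev : X → R →+* ℝ} {ev' : Y → R' →+* ℝ}
  {A B : X → Prop}

theorem congr (hA : SignDefinable ev A) (h : ∀ x, B x ↔ A x) : SignDefinable ev B := by
  rwa [show B = A from funext fun x => propext (h x)]

theorem or (hA : SignDefinable ev A) (hB : SignDefinable ev B) :
    SignDefinable ev fun x => A x ∨ B x :=
  (hA.not.and hB.not).not.congr fun x => by tauto

theorem eq_zero (r : R) : SignDefinable ev fun x => ev x r = 0 :=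
  ((pos r).not.and (pos (-r)).not).congr fun x => by
    rw [map_neg]; constructor
    · intro h; simp [h]
    · rintro ⟨h₁, h₂⟩; linarith

theorem false : SignDefinable ev fun _ => False :=
  (pos 0).congr fun x => by simp

theorem exists_mem_finset {ι : Type*} (s : Finset ι) {A : ι → X → Prop}
    (h : ∀ i ∈ s, SignDefinable ev (A i)) : SignDefinable ev fun x => ∃ i ∈ s, A i x := by
  classical
  induction s using Finset.induction_on with
  | empty => exact false.congr fun x => by simp
  | insert i s _ ih =>
    exact ((h i (by simp)).or (ih fun j hj => h j (by simp [hj]))).congr fun x => by simp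

theorem forall_fintype {ι : Type*} [Finite ι] {A : ι → X → Prop}
    (h : ∀ i, SignDefinable ev (A i)) : SignDefinable ev fun x => ∀ i, A i x := by
  have := Fintype.ofFinite ι
  exact (exists_mem_finset Finset.univ fun i _ => (h i).not).not.congr fun x => by simp

theorem comap (hA : SignDefinable ev A) (g : Y → X)
    (h : ∀ r, ∃ r', ∀ y, ev' y r' = ev (g y) r) : SignDefinable ev' fun y => A (g y) := by
  induction hA with
  | pos r =>
    obtain ⟨r', hr⟩ := h r
    exact (pos r').congr fun y => by rw [hr]
  | not _ ih => exact ih.not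
  | and _ _ ih₁ ih₂ => exact ih₁.and ih₂

end SignDefinable

/-! ### Adjoining one real variable -/

open Polynomial

/-- The evaluation of polynomials with coefficients in `R` at points of `X × ℝ`. -/
noncomputable def evalSnd {X R : Type*} [CommRing R] (ev : X → R →+* ℝ) (y : X × ℝ) :
    R[X] →+* ℝ :=
  eval₂RingHom (ev y.1) y.2

theorem evalSnd_apply {X R : Type*} [CommRing R] (ev : X → R →+* ℝ) (y : X × ℝ) (P : R[X]) :
    evalSnd ev y P = (P.map (ev y.1)).eval y.2 := by
  simp [evalSnd, eval_map]

@[simp] theorem evalSnd_C {X R : Type*} [CommRing R] (ev : X → R →+* ℝ) (y : X × ℝ) (r : R) :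
    evalSnd ev y (C r) = ev y.1 r := by
  simp [evalSnd]

@[simp] theorem evalSnd_X {X R : Type*} [CommRing R] (ev : X → R →+* ℝ) (y : X × ℝ) :
    evalSnd ev y Polynomial.X = y.2 := by
  simp [evalSnd]

/-- The identity is the only ring endomorphism of `ℝ`, so evaluations need not be assumed
`ℝ`-linear. This makes the constant `2⁻¹` available for midpoints. -/
theorem map_algebraMap_real {R : Type*} [CommRing R] [Algebra ℝ R] (f : R →+* ℝ) (c : ℝ) :
    f (algebraMap ℝ R c) = c :=
  RingHom.congr_fun (Subsingleton.elim (f.comp (algebraMap ℝ R)) (RingHom.id ℝ)) c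

namespace SignDefinable

variable {X Y R R' : Type*} [CommRing R] [CommRing R'] {ev : X → R →+* ℝ} {ev' : Y → R' →+* ℝ}

/-- Substitution of a polynomial function for the last variable. -/
theorem subst {A : X × ℝ → Prop} (hA : SignDefinable (evalSnd ev) A) (g : Y → X) (φ : R →+* R')
    (hφ : ∀ y r, ev' y (φ r) = ev (g y) r) (q : R') :
    SignDefinable ev' fun y => A (g y, ev' y q) :=
  hA.comap (fun y => (g y, ev' y q)) fun P => ⟨eval₂ φ q P, fun y => by
    rw [hom_eval₂, evalSnd_apply, eval_map]
    congr 1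
    ext r
    exact hφ y r⟩

end SignDefinable

/-- Pseudo-division with remainder. -/
theorem Polynomial.exists_pow_leadingCoeff_mul_eq {R : Type*} [CommRing R] (P r : R[X])
    (hP : P.natDegree ≠ 0) : ∃ (k : ℕ) (s r' : R[X]),
      C (P.leadingCoeff ^ k) * r = P * s + r' ∧ r'.natDegree < P.natDegree := by
  induction hn : r.natDegree using Nat.strong_induction_on generalizing r with
  | _ n ih =>
    subst hn
    by_cases h : r.natDegree < P.natDegree
    · exact ⟨0, 0, r, by simp, h⟩
    push Not at h
    -- One division step: multiply `r` by the leading coefficient of `P` and subtract the multiple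
    -- of `P` that cancels the top term.
    obtain ⟨k, s, r', h₁, h₂⟩ := ih _ (natDegree_cancelLeads_lt_of_natDegree_le_natDegree h
      (by omega)) _ rfl
    refine ⟨k + 1, s + C (P.leadingCoeff ^ k) * (C r.leadingCoeff * Polynomial.X ^
        (r.natDegree - P.natDegree)), r', ?_, h₂⟩
    rw [cancelLeads, Nat.sub_eq_zero_of_le h, pow_zero, mul_one] at h₁
    rw [pow_succ, C_mul]
    linear_combination h₁

/-! ### Nodes and gaps of finitely many real polynomials -/

/-- The nodes of a set `Q` of real polynomials: the endpoints of the unit interval and the points of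
the unit interval where a nonzero member of `Q` vanishes. -/
def IsNode (Q : Set ℝ[X]) (a : ℝ) : Prop :=
  a ∈ Set.Icc (0 : ℝ) 1 ∧ (a = 0 ∨ a = 1 ∨ ∃ q ∈ Q, q ≠ 0 ∧ q.eval a = 0)

/-- `a < b` are consecutive nodes of `Q`. -/
def IsGap (Q : Set ℝ[X]) (a b : ℝ) : Prop :=
  IsNode Q a ∧ IsNode Q b ∧ a < b ∧ ∀ c, IsNode Q c → ¬ (a < c ∧ c < b)

theorem finite_isNode {Q : Set ℝ[X]} (hQ : Q.Finite) : {a | IsNode Q a}.Finite := by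
  have h : ({0, 1} ∪ ⋃ q ∈ Q, (q.roots.toFinset : Set ℝ)).Finite :=
    (Set.toFinite _).union (hQ.biUnion fun q _ => q.roots.toFinset.finite_toSet)
  refine h.subset ?_
  rintro a ⟨-, h | h | ⟨q, hq, h₀, ha⟩⟩
  · simp [h]
  · simp [h]
  · refine Or.inr (Set.mem_biUnion hq ?_)
    simp [h₀, ha]

theorem exists_isGap {Q : Set ℝ[X]} (hQ : Q.Finite) {t : ℝ} (ht : t ∈ Set.Icc (0 : ℝ) 1)
    (hn : ¬ IsNode Q t) : ∃ a b, IsGap Q a b ∧ t ∈ Set.Ioo a b := by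
  have hfin := finite_isNode hQ
  obtain ⟨a, ⟨ha, hat⟩, hmax⟩ := Set.exists_max_image ({a | IsNode Q a} ∩ Set.Iic t) id
    (hfin.inter_of_left _) ⟨0, ⟨by simp, Or.inl rfl⟩, ht.1⟩
  obtain ⟨b, ⟨hb, htb⟩, hmin⟩ := Set.exists_min_image ({a | IsNode Q a} ∩ Set.Ici t) id
    (hfin.inter_of_left _) ⟨1, ⟨by simp, Or.inr (Or.inl rfl)⟩, ht.2⟩
  have hat' : a < t := lt_of_le_of_ne hat fun h => hn (h ▸ ha)
  have htb' : t < b := lt_of_le_of_ne htb fun h => hn (h ▸ hb)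
  refine ⟨a, b, ⟨ha, hb, hat'.trans htb', fun c hc ⟨h₁, h₂⟩ => ?_⟩, hat', htb'⟩
  rcases le_total c t with h | h
  · exact absurd (hmax c ⟨hc, h⟩) (not_le.2 h₁)
  · exact absurd (hmin c ⟨hc, h⟩) (not_le.2 h₂)

theorem Polynomial.exists_eval_eq_zero_of_mul_neg (P : ℝ[X]) {a b : ℝ} (hab : a < b)
    (h : P.eval a * P.eval b < 0) : ∃ t ∈ Set.Ioo a b, P.eval t = 0 := by
  rcases mul_neg_iff.1 h with ⟨h₁, h₂⟩ | ⟨h₁, h₂⟩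
  · exact intermediate_value_Ioo' hab.le P.continuous.continuousOn ⟨h₂, h₁⟩
  · exact intermediate_value_Ioo hab.le P.continuous.continuousOn ⟨h₁, h₂⟩

namespace IsGap

variable {Q : Set ℝ[X]} {a b : ℝ}

theorem eval_ne_zero (h : IsGap Q a b) {q : ℝ[X]} (hq : q ∈ Q) (h₀ : q ≠ 0) {t : ℝ}
    (ht : t ∈ Set.Ioo a b) : q.eval t ≠ 0 := fun h' =>
  h.2.2.2 t ⟨⟨h.1.1.1.trans ht.1.le, ht.2.le.trans h.2.1.1.2⟩, Or.inr (Or.inr ⟨q, hq, h₀, h'⟩)⟩ ht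

theorem mul_pos (h : IsGap Q a b) {q : ℝ[X]} (hq : q ∈ Q) (h₀ : q ≠ 0) {t t' : ℝ}
    (ht : t ∈ Set.Ioo a b) (ht' : t' ∈ Set.Ioo a b) : 0 < q.eval t * q.eval t' := by
  by_contra hneg
  have hne := mul_ne_zero (h.eval_ne_zero hq h₀ ht) (h.eval_ne_zero hq h₀ ht')
  have hlt := lt_of_le_of_ne (not_lt.1 hneg) hne
  rcases lt_trichotomy t t' with h' | h' | h'
  · obtain ⟨c, hc, hc₀⟩ := q.exists_eval_eq_zero_of_mul_neg h' hlt
    exact h.eval_ne_zero hq h₀ ⟨ht.1.trans hc.1, hc.2.trans ht'.2⟩ hc₀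
  · subst h'
    exact hneg (mul_self_pos.2 (h.eval_ne_zero hq h₀ ht))
  · obtain ⟨c, hc, hc₀⟩ := q.exists_eval_eq_zero_of_mul_neg h' (by rwa [mul_comm])
    exact h.eval_ne_zero hq h₀ ⟨ht'.1.trans hc.1, hc.2.trans ht.2⟩ hc₀

theorem pos_iff (h : IsGap Q a b) {q : ℝ[X]} (hq : q ∈ Q) {t t' : ℝ}
    (ht : t ∈ Set.Ioo a b) (ht' : t' ∈ Set.Ioo a b) : 0 < q.eval t ↔ 0 < q.eval t' := by
  by_cases h₀ : q = 0
  · simp [h₀]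
  · have := h.mul_pos hq h₀ ht ht'
    exact ⟨fun h' => (pos_iff_pos_of_mul_pos this).1 h', fun h' => (pos_iff_pos_of_mul_pos this).2 h'⟩

/-- The derivative has constant sign on the gap, so `P` is strictly monotone on its closure and an
interior root forces opposite strict signs at the endpoints. The converse is the intermediate value
theorem. -/
theorem eval_mul_eval_neg (h : IsGap Q a b) {P : ℝ[X]} (hP : derivative P ∈ Q)
    (h₀ : derivative P ≠ 0) {t : ℝ} (ht : t ∈ Set.Ioo a b) (hroot : P.eval t = 0) :
    P.eval a * P.eval b < 0 := by
  have hab : a ≤ b := h.2.2.1.le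
  have htab := Set.Ioo_subset_Icc_self ht
  rcases (h.eval_ne_zero hP h₀ ht).lt_or_gt with hd | hd
  · have hanti : StrictAntiOn (fun x => P.eval x) (Set.Icc a b) := by
      refine strictAntiOn_of_deriv_neg (convex_Icc a b) P.continuous.continuousOn fun x hx => ?_
      rw [interior_Icc] at hx
      rw [Polynomial.deriv]
      have := h.mul_pos hP h₀ ht hx
      nlinarith
    have h₁ := hanti (Set.left_mem_Icc.2 hab) htab ht.1
    have h₂ := hanti htab (Set.right_mem_Icc.2 hab) ht.2
    simp only [hroot] at h₁ h₂
    exact mul_neg_of_pos_of_neg h₁ h₂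
  · have hmono : StrictMonoOn (fun x => P.eval x) (Set.Icc a b) := by
      refine strictMonoOn_of_deriv_pos (convex_Icc a b) P.continuous.continuousOn fun x hx => ?_
      rw [interior_Icc] at hx
      rw [Polynomial.deriv]
      exact (pos_iff_pos_of_mul_pos (h.mul_pos hP h₀ ht hx)).1 hd
    have h₁ := hmono (Set.left_mem_Icc.2 hab) htab ht.1
    have h₂ := hmono htab (Set.right_mem_Icc.2 hab) ht.2
    simp only [hroot] at h₁ h₂
    exact mul_neg_of_neg_of_pos h₁ h₂

theorem midpoint_mem (h : IsGap Q a b) : (a + b) * 2⁻¹ ∈ Set.Ioo a b := by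
  have := h.2.2.1
  constructor <;> linarith

end IsGap

-- Eliminating a quantifier over roots

universe u v

/-- Quantification over the roots in the unit interval of a polynomial of degree less than `n`
preserves definability. -/
def RootElimination (n : ℕ) : Prop :=
  ∀ {X : Type u} {R : Type v} [CommRing R] [Algebra ℝ R] (ev : X → R →+* ℝ) (P : R[X]),
    P.natDegree < n → ∀ A : X × ℝ → Prop, SignDefinable (evalSnd ev) A →
      SignDefinable ev fun x => P.map (ev x) ≠ 0 ∧
        ∃ t ∈ Set.Icc (0 : ℝ) 1, (P.map (ev x)).eval t = 0 ∧ A (x, t)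

section

variable {X : Type u} {R : Type v} [CommRing R] {ev : X → R →+* ℝ} {n : ℕ}

namespace RootElimination

/-- A node is `0`, `1` or a root of a member of `Q` that stays nonzero after specialisation, so this
is a finite disjunction of substitutions and root eliminations. -/
theorem exists_isNode [Algebra ℝ R] (hn : RootElimination.{u, v} n) (Q : Finset R[X])
    (hQ : ∀ q ∈ Q, q.natDegree < n) {A : X × ℝ → Prop} (hA : SignDefinable (evalSnd ev) A) :
    SignDefinable ev fun x => ∃ a, IsNode (Polynomial.map (ev x) '' Q) a ∧ A (x, a) := by
  have h₀ : SignDefinable ev fun x => A (x, 0) :=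
    (hA.subst id (RingHom.id R) (fun _ _ => rfl) 0).congr fun x => by simp
  have h₁ : SignDefinable ev fun x => A (x, 1) :=
    (hA.subst id (RingHom.id R) (fun _ _ => rfl) 1).congr fun x => by simp
  refine ((h₀.or h₁).or (SignDefinable.exists_mem_finset Q fun q hq =>
    hn ev q (hQ q hq) A hA)).congr fun x => ?_
  constructor
  · rintro ⟨a, ⟨hI, rfl | rfl | ⟨_, ⟨q, hq, rfl⟩, hne, hz⟩⟩, ha⟩
    · exact Or.inl (Or.inl ha)
    · exact Or.inl (Or.inr ha)
    · exact Or.inr ⟨q, hq, hne, a, hI, hz, ha⟩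
  · rintro ((ha | ha) | ⟨q, hq, hne, a, hI, hz, ha⟩)
    · exact ⟨0, ⟨by simp, Or.inl rfl⟩, ha⟩
    · exact ⟨1, ⟨by simp, Or.inr (Or.inl rfl)⟩, ha⟩
    · exact ⟨a, ⟨hI, Or.inr (Or.inr ⟨_, ⟨q, hq, rfl⟩, hne, hz⟩)⟩, ha⟩

theorem image_map_evalSnd [DecidableEq R[X][X]] (ev : X → R →+* ℝ) (Q : Finset R[X]) (y : X × ℝ) :
    Polynomial.map (evalSnd ev y) '' (Q.image (Polynomial.map C) : Finset R[X][X]) =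
      Polynomial.map (ev y.1) '' Q := by
  rw [Finset.coe_image, Set.image_image]
  refine Set.image_congr fun q _ => ?_
  rw [Polynomial.map_map]
  congr 1
  ext r
  simp

/-- The nodes still depend on `x` alone while the condition carries an extra variable; the
hypothesis applies because `RootElimination` ranges over all parameter spaces and rings. -/
theorem exists_isNode_snd [Algebra ℝ R] (hn : RootElimination.{u, v} n) (Q : Finset R[X])
    (hQ : ∀ q ∈ Q, q.natDegree < n) {A : (X × ℝ) × ℝ → Prop}
    (hA : SignDefinable (evalSnd (evalSnd ev)) A) :
    SignDefinable (evalSnd ev) fun y =>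
      ∃ a, IsNode (Polynomial.map (ev y.1) '' Q) a ∧ A (y, a) := by
  classical
  refine (hn.exists_isNode (Q.image (Polynomial.map C)) (fun q hq => ?_) hA).congr fun y => ?_
  · obtain ⟨q, hq', rfl⟩ := Finset.mem_image.1 hq
    exact natDegree_map_le.trans_lt (hQ q hq')
  · rw [image_map_evalSnd]

theorem exists_isNode_snd_snd [Algebra ℝ R] (hn : RootElimination.{u, v} n) (Q : Finset R[X])
    (hQ : ∀ q ∈ Q, q.natDegree < n) {A : ((X × ℝ) × ℝ) × ℝ → Prop}
    (hA : SignDefinable (evalSnd (evalSnd (evalSnd ev))) A) :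
    SignDefinable (evalSnd (evalSnd ev)) fun y =>
      ∃ a, IsNode (Polynomial.map (ev y.1.1) '' Q) a ∧ A (y, a) := by
  classical
  refine (hn.exists_isNode_snd (Q.image (Polynomial.map C)) (fun q hq => ?_) hA).congr fun y => ?_
  · obtain ⟨q, hq', rfl⟩ := Finset.mem_image.1 hq
    exact natDegree_map_le.trans_lt (hQ q hq')
  · rw [image_map_evalSnd]

/-- Being a gap is expressed by three nested quantifiers over nodes: `a`, then `b`, then no node
strictly between them. -/
theorem exists_isGap [Algebra ℝ R] (hn : RootElimination.{u, v} n) (Q : Finset R[X])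
    (hQ : ∀ q ∈ Q, q.natDegree < n) {A : (X × ℝ) × ℝ → Prop}
    (hA : SignDefinable (evalSnd (evalSnd ev)) A) :
    SignDefinable ev fun x =>
      ∃ a b, IsGap (Polynomial.map (ev x) '' Q) a b ∧ A ((x, a), b) := by
  have hlt : SignDefinable (evalSnd (evalSnd ev)) fun y => y.1.2 < y.2 :=
    (SignDefinable.pos (Polynomial.X - C Polynomial.X)).congr fun y => by simp
  have hbetween : SignDefinable (evalSnd (evalSnd (evalSnd ev))) fun z =>
      z.1.1.2 < z.2 ∧ z.2 < z.1.2 :=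
    ((SignDefinable.pos (Polynomial.X - C (C Polynomial.X))).and
      (SignDefinable.pos (C Polynomial.X - Polynomial.X))).congr fun y => by simp
  refine (hn.exists_isNode Q hQ (hn.exists_isNode_snd Q hQ
    (hlt.and ((hn.exists_isNode_snd_snd Q hQ hbetween).not.and hA)))).congr fun x => ?_
  constructor
  · rintro ⟨a, b, ⟨ha, hb, hab, hno⟩, h⟩
    exact ⟨a, ha, b, hb, hab, fun ⟨c, hc, h'⟩ => hno c hc h', h⟩
  · rintro ⟨a, ha, b, hb, hab, hno, h⟩
    exact ⟨a, b, ⟨ha, hb, hab, fun c hc h' => hno ⟨c, hc, h'⟩⟩, h⟩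

end RootElimination

/-- A predicate depends on the last variable only through the positivity of finitely many
polynomials. -/
def DependsOnSigns (ev : X → R →+* ℝ) (Q : Finset R[X]) (A : X × ℝ → Prop) : Prop :=
  ∀ x t t', (∀ q ∈ Q, 0 < (q.map (ev x)).eval t ↔ 0 < (q.map (ev x)).eval t') →
    (A (x, t) ↔ A (x, t'))

namespace SignDefinable

theorem exists_dependsOnSigns {A : X × ℝ → Prop} (hA : SignDefinable (evalSnd ev) A) :
    ∃ Q : Finset R[X], DependsOnSigns ev Q A := by
  classical
  induction hA with
  | pos r =>
    exact ⟨{r}, fun x t t' h => by simpa [evalSnd_apply] using h⟩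
  | not _ ih =>
    obtain ⟨Q, hQ⟩ := ih
    exact ⟨Q, fun x t t' h => not_congr (hQ x t t' h)⟩
  | and _ _ ih₁ ih₂ =>
    obtain ⟨Q₁, h₁⟩ := ih₁
    obtain ⟨Q₂, h₂⟩ := ih₂
    exact ⟨Q₁ ∪ Q₂, fun x t t' h => and_congr
      (h₁ x t t' fun q hq => h q (by simp [hq])) (h₂ x t t' fun q hq => h q (by simp [hq]))⟩

/-- At the roots of a polynomial `P` with nonvanishing leading coefficient, a definable predicate
is given by polynomials of smaller degree than `P`. -/
theorem exists_reduction (P : R[X]) (hP : P.natDegree ≠ 0) {A : X × ℝ → Prop}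
    (hA : SignDefinable (evalSnd ev) A) :
    ∃ (Q : Finset R[X]) (A' : X × ℝ → Prop), SignDefinable (evalSnd ev) A' ∧
      (∀ q ∈ Q, q.natDegree < P.natDegree) ∧ DependsOnSigns ev Q A' ∧
      ∀ x t, ev x P.leadingCoeff ≠ 0 → (P.map (ev x)).eval t = 0 → (A (x, t) ↔ A' (x, t)) := by
  classical
  induction hA with
  | pos r =>
    obtain ⟨k, s, r', h, hr'⟩ := P.exists_pow_leadingCoeff_mul_eq r hP
    -- The extra factor makes the total multiplier of `r` a nonzero square at roots of `P`, so the
    -- sign is kept even when the leading coefficient is negative and `k` is odd.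
    refine ⟨{C (P.leadingCoeff ^ k) * r'}, _, .pos (C (P.leadingCoeff ^ k) * r'), ?_, ?_, ?_⟩
    · intro q hq
      rw [Finset.mem_singleton.1 hq]
      exact (natDegree_C_mul_le _ _).trans_lt hr'
    · intro x t t' h
      simpa only [evalSnd_apply, Finset.mem_singleton, forall_eq] using h
    · intro x t ha hroot
      have h' := congrArg (evalSnd ev (x, t)) h
      rw [← evalSnd_apply ev (x, t)] at hroot
      simp only [map_mul, map_add, evalSnd_C, hroot, zero_mul, zero_add] at h' ⊢
      rw [← h', ← mul_assoc, ← sq]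
      exact (mul_pos_iff_of_pos_left (by rw [map_pow]; positivity)).symm
  | not _ ih =>
    obtain ⟨Q, A', hA', hdeg, hQ, h⟩ := ih
    exact ⟨Q, _, hA'.not, hdeg, fun x t t' h => not_congr (hQ x t t' h),
      fun x t h₁ h₂ => not_congr (h x t h₁ h₂)⟩
  | and _ _ ih₁ ih₂ =>
    obtain ⟨Q₁, A₁, hA₁, hd₁, hQ₁, h₁⟩ := ih₁
    obtain ⟨Q₂, A₂, hA₂, hd₂, hQ₂, h₂⟩ := ih₂
    refine ⟨Q₁ ∪ Q₂, _, hA₁.and hA₂, ?_, fun x t t' h => and_congr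
      (hQ₁ x t t' fun q hq => h q (by simp [hq])) (hQ₂ x t t' fun q hq => h q (by simp [hq])),
      fun x t h h' => and_congr (h₁ x t h h') (h₂ x t h h')⟩
    intro q hq
    exact (Finset.mem_union.1 hq).elim (hd₁ q) (hd₂ q)

theorem midpoint [Algebra ℝ R] {A : X × ℝ → Prop} (hA : SignDefinable (evalSnd ev) A) :
    SignDefinable (evalSnd (evalSnd ev)) fun y => A (y.1.1, (y.1.2 + y.2) * 2⁻¹) :=
  (hA.subst (fun y : (X × ℝ) × ℝ => y.1.1) (C.comp C) (fun y r => by simp)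
    ((C Polynomial.X + Polynomial.X) * algebraMap ℝ _ 2⁻¹)).congr fun y => by
      rw [map_mul, map_algebraMap_real]; simp

theorem endpoints_mul_neg (P : R[X]) :
    SignDefinable (evalSnd (evalSnd ev)) fun y =>
      (P.map (ev y.1.1)).eval y.1.2 * (P.map (ev y.1.1)).eval y.2 < 0 :=
  (pos (-(C P * P.map C))).congr fun y => by
    rw [map_neg, map_mul, evalSnd_C, evalSnd_apply, evalSnd_apply, Polynomial.map_map,
      neg_pos, show (evalSnd ev y.1).comp C = ev y.1.1 by ext r; simp]

end SignDefinable

theorem DependsOnSigns.iff_of_isGap {Q Q' : Finset R[X]} {A : X × ℝ → Prop}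
    (hA : DependsOnSigns ev Q A) (hQ : Q ⊆ Q') {x : X} {a b : ℝ}
    (h : IsGap (Polynomial.map (ev x) '' Q') a b) {t t' : ℝ} (ht : t ∈ Set.Ioo a b)
    (ht' : t' ∈ Set.Ioo a b) : A (x, t) ↔ A (x, t') :=
  hA x t t' fun q hq => h.pos_iff ⟨q, hQ hq, rfl⟩ ht ht'

end

theorem IsGap.Ioo_subset {Q : Set ℝ[X]} {a b : ℝ} (h : IsGap Q a b) :
    Set.Ioo a b ⊆ Set.Icc (0 : ℝ) 1 := fun _ ht =>
  ⟨h.1.1.1.trans ht.1.le, ht.2.le.trans h.2.1.1.2⟩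

/-- If the leading coefficient vanishes at `x`, drop the leading term. Otherwise use the nodes of
`P'` and of the reduced condition, all of smaller degree: a root of `P` is either a node or lies
inside a gap. In a gap, its existence is a sign change of `P` at the endpoints, and the reduced
condition can be read off at the midpoint instead of at the root. -/
theorem rootElimination (n : ℕ) : RootElimination.{u, v} n := by
  classical
  induction n with
  | zero => intro X R _ _ ev P hP; omega
  | succ n hn =>
    intro X R _ _ ev P hPn A hA
    by_cases hP : P.natDegree = 0
    · refine SignDefinable.false.congr fun x => ?_
      rw [eq_C_of_natDegree_eq_zero hP]
      simp only [Polynomial.map_C, eval_C, iff_false]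
      rintro ⟨h, t, -, h', -⟩
      exact h (by rw [h', C_0])
    obtain ⟨Q, A', hA', hdeg, hQ, hred⟩ := hA.exists_reduction P hP
    have hQn : ∀ q ∈ insert (derivative P) Q, q.natDegree < n := by
      intro q hq
      have hd := natDegree_derivative_lt hP
      rcases Finset.mem_insert.1 hq with rfl | hq
      · omega
      · have := hdeg q hq
        omega
    -- The degree drops strictly because `P` is not constant.
    have herase : SignDefinable ev _ := hn ev P.eraseLead (by
      have := P.eraseLead_natDegree_le
      omega) A hA
    have hlc : SignDefinable ev fun x => ev x P.leadingCoeff = 0 := .eq_zero _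
    have hroot : SignDefinable (evalSnd ev) fun y => (P.map (ev y.1)).eval y.2 = 0 :=
      (SignDefinable.eq_zero P).congr fun y => by rw [evalSnd_apply]
    have hnode := hn.exists_isNode _ hQn (hroot.and hA)
    have hgap := hn.exists_isGap _ hQn
      ((SignDefinable.endpoints_mul_neg (ev := ev) P).and hA'.midpoint)
    refine ((hlc.and herase).or (hlc.not.and (hnode.or hgap))).congr fun x => ?_
    by_cases ha : ev x P.leadingCoeff = 0
    · have : P.map (ev x) = P.eraseLead.map (ev x) := by
        conv_lhs => rw [← P.eraseLead_add_C_mul_X_pow]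
        rw [Polynomial.map_add, Polynomial.map_mul, Polynomial.map_C, ha, C_0, zero_mul, add_zero]
      simp only [ha, not_true_eq_false, false_and, or_false, true_and, this]
    have hPdeg : (P.map (ev x)).natDegree = P.natDegree := natDegree_map_of_leadingCoeff_ne_zero _ ha
    have hPx : P.map (ev x) ≠ 0 := by
      intro h
      rw [h, natDegree_zero] at hPdeg
      exact hP hPdeg.symm
    have hPd : derivative (P.map (ev x)) ≠ 0 := by
      intro h
      exact hP (hPdeg ▸ derivative_eq_zero.1 h)
    have hPmem : derivative (P.map (ev x)) ∈
        Polynomial.map (ev x) '' (insert (derivative P) Q : Finset R[X]) :=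
      ⟨derivative P, by simp, (derivative_map P (ev x)).symm⟩
    simp only [ha, false_and, false_or, not_false_eq_true, true_and, ne_eq, hPx]
    constructor
    · rintro ⟨t, hI, hz, hAt⟩
      by_cases ht : IsNode (Polynomial.map (ev x) '' (insert (derivative P) Q : Finset R[X])) t
      · exact Or.inl ⟨t, ht, hz, hAt⟩
      · obtain ⟨a, b, hab, htab⟩ := exists_isGap (Set.toFinite _) hI ht
        exact Or.inr ⟨a, b, hab, hab.eval_mul_eval_neg hPmem hPd htab hz,
          (hQ.iff_of_isGap (Finset.subset_insert _ _) hab htab hab.midpoint_mem).1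
            ((hred x t ha hz).1 hAt)⟩
    · rintro (⟨t, ht, hz, hAt⟩ | ⟨a, b, hab, hneg, hAm⟩)
      · exact ⟨t, ht.1, hz, hAt⟩
      · obtain ⟨t, ht, hz⟩ := (P.map (ev x)).exists_eval_eq_zero_of_mul_neg hab.2.2.1 hneg
        exact ⟨t, hab.Ioo_subset ht, hz, (hred x t ha hz).2
          ((hQ.iff_of_isGap (Finset.subset_insert _ _) hab ht hab.midpoint_mem).2 hAm)⟩

/-! ### Eliminating quantifiers over the unit interval and the unit cube -/

namespace SignDefinable

/-- Quantification over the unit interval preserves definability. -/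
theorem exists_mem_Icc {X : Type u} {R : Type v} [CommRing R] [Algebra ℝ R] {ev : X → R →+* ℝ}
    {A : X × ℝ → Prop} (hA : SignDefinable (evalSnd ev) A) :
    SignDefinable ev fun x => ∃ t ∈ Set.Icc (0 : ℝ) 1, A (x, t) := by
  obtain ⟨Q, hQ⟩ := hA.exists_dependsOnSigns
  have hdeg : ∀ q ∈ Q, q.natDegree < Q.sup natDegree + 1 := fun q hq =>
    Nat.lt_succ_of_le (Finset.le_sup (f := natDegree) hq)
  have hn : RootElimination.{u, v} (Q.sup natDegree + 1) := rootElimination _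
  refine ((hn.exists_isNode Q hdeg hA).or (hn.exists_isGap Q hdeg hA.midpoint)).congr fun x => ?_
  constructor
  · rintro ⟨t, hI, hAt⟩
    by_cases ht : IsNode (Polynomial.map (ev x) '' Q) t
    · exact Or.inl ⟨t, ht, hAt⟩
    · obtain ⟨a, b, hab, htab⟩ := exists_isGap (Set.toFinite _) hI ht
      exact Or.inr ⟨a, b, hab,
        (hQ.iff_of_isGap (Finset.Subset.refl _) hab htab hab.midpoint_mem).1 hAt⟩
  · rintro (⟨t, ht, hAt⟩ | ⟨a, b, hab, hAm⟩)
    · exact ⟨t, ht.1, hAt⟩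
    · exact ⟨_, hab.Ioo_subset hab.midpoint_mem, hAm⟩

/-- Quantification over the points of a unit cube preserves definability. -/
theorem exists_forall_mem_Icc {X : Type u} {R : Type v} [CommRing R] [Algebra ℝ R]
    {ev : X → R →+* ℝ} {m : ℕ} {A : X × (Fin m → ℝ) → Prop}
    (hA : SignDefinable (fun y => MvPolynomial.eval₂Hom (ev y.1) y.2) A) :
    SignDefinable ev fun x => ∃ v : Fin m → ℝ, (∀ i, v i ∈ Set.Icc (0 : ℝ) 1) ∧ A (x, v) := by
  induction m with
  | zero =>
    refine (hA.comap (ev' := ev) (fun x => (x, Fin.elim0)) fun r => ?_).congr fun x => ?_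
    · induction r using MvPolynomial.induction_on with
      | C a => exact ⟨a, fun y => by simp⟩
      | add p q hp hq =>
        obtain ⟨p', hp⟩ := hp
        obtain ⟨q', hq⟩ := hq
        exact ⟨p' + q', fun y => by rw [map_add, map_add, hp, hq]⟩
      | mul_X p i hp => exact i.elim0
    · constructor
      · rintro ⟨v, -, hv⟩
        rwa [Subsingleton.elim Fin.elim0 v]
      · intro h
        exact ⟨_, fun i => i.elim0, h⟩
  | succ m ih =>
    -- The first coordinate of the cube becomes the last variable, to be eliminated before the
    -- remaining `m`.
    have hA' : SignDefinable (evalSnd fun y : X × (Fin m → ℝ) =>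
        MvPolynomial.eval₂Hom (ev y.1) y.2) fun z => A (z.1.1, Fin.cons z.2 z.1.2) := by
      refine hA.comap (fun z : (X × (Fin m → ℝ)) × ℝ =>
        (z.1.1, (Fin.cons z.2 z.1.2 : Fin (m + 1) → ℝ))) fun r => ?_
      induction r using MvPolynomial.induction_on with
      | C a => exact ⟨C (MvPolynomial.C a), fun y => by simp⟩
      | add p q hp hq =>
        obtain ⟨p', hp⟩ := hp
        obtain ⟨q', hq⟩ := hq
        exact ⟨p' + q', fun y => by rw [map_add, map_add, hp, hq]⟩
      | mul_X p i hp =>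
        obtain ⟨p', hp⟩ := hp
        induction i using Fin.cases with
        | zero => exact ⟨p' * Polynomial.X, fun y => by rw [map_mul, map_mul, hp]; simp⟩
        | succ i =>
          exact ⟨p' * C (MvPolynomial.X i), fun y => by rw [map_mul, map_mul, hp]; simp⟩
    refine (ih hA'.exists_mem_Icc).congr fun x => ?_
    constructor
    · rintro ⟨v, hv, h⟩
      exact ⟨Fin.tail v, fun i => hv i.succ, v 0, hv 0, by simpa using h⟩
    · rintro ⟨v, hv, t, ht, h⟩
      exact ⟨Fin.cons t v, fun i => Fin.cases ht hv i, h⟩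

end SignDefinable

/-! ### Completable partial tensors -/

theorem SignDefinable.isSemialgebraic {ι : Type} {A : (ι → ℝ) → Prop}
    (hA : SignDefinable (fun x => MvPolynomial.eval x) A) : IsSemialgebraic {x | A x} := by
  induction hA with
  | pos p => exact .pos p
  | not _ ih => exact ih.compl
  | and _ _ ih₁ ih₂ => exact ih₁.inter ih₂

theorem Finset.sum_prod_apply_eq_prod_sum {d : ℕ} {n : Fin d → ℕ}
    (u : ∀ k : Fin d, Fin (n k) → ℝ) : ∑ i : (∀ k, Fin (n k)), ∏ k, u k (i k) =
      ∏ k, ∑ j, u k j := by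
  rw [Finset.prod_univ_sum, Fintype.piFinset_univ]

/-- A partial tensor is completable to a rank-one tensor in the standard simplex if and only if it
is completable to an outer product of probability vectors. -/
theorem PartialTensor.isCompletable_iff {d : ℕ} {n : Fin d → ℕ}
    {S : Set (∀ k : Fin d, Fin (n k))} (M : PartialTensor S) :
    M.IsCompletable ↔ ∃ u : ∀ k : Fin d, Fin (n k) → ℝ,
      (∀ k, u k ∈ stdSimplex ℝ (Fin (n k))) ∧ ∀ s : S, ∏ k, u k (s.1 k) = M s := by
  constructor
  · rintro ⟨T, ⟨hT₀, hT₁⟩, ⟨-, u, hu⟩, hTM⟩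
    have habs : ∀ i, T i = ∏ k, |u k (i k)| := fun i => by
      rw [← Finset.abs_prod, ← hu, abs_of_nonneg (hT₀ i)]
    have hprod : ∏ k, ∑ j, |u k j| = 1 := by
      rw [← Finset.sum_prod_apply_eq_prod_sum fun k j => |u k j|, ← hT₁]
      exact Finset.sum_congr rfl fun i _ => (habs i).symm
    have hne : ∀ k, ∑ j, |u k j| ≠ 0 := fun k =>
      Finset.prod_ne_zero_iff.1 (hprod ▸ one_ne_zero) k (Finset.mem_univ k)
    -- The normalising constants multiply to one by `hprod`, so rescaling the factors leaves the
    -- tensor unchanged.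
    refine ⟨fun k j => |u k j| / ∑ j, |u k j|, fun k => ⟨fun j => by positivity, ?_⟩, fun s => ?_⟩
    · rw [← Finset.sum_div, div_self (hne k)]
    · rw [Finset.prod_div_distrib, hprod, div_one, ← habs, hTM]
  · rintro ⟨u, hu, hM⟩
    have hsum : ∑ i : (∀ k, Fin (n k)), ∏ k, u k (i k) = 1 := by
      rw [Finset.sum_prod_apply_eq_prod_sum]
      exact Finset.prod_eq_one fun k _ => (hu k).2
    refine ⟨fun i => ∏ k, u k (i k), ⟨fun i => Finset.prod_nonneg fun k _ => (hu k).1 _, hsum⟩,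
      ⟨fun h => ?_, u, fun _ => rfl⟩, hM⟩
    rw [Finset.sum_eq_zero fun i _ => congrFun h i] at hsum
    exact zero_ne_one hsum

theorem proposition5p1 (d : ℕ) (n : Fin d → ℕ) (S : Set (∀ k : Fin d, Fin (n k))) :
    IsSemialgebraic {M : PartialTensor S | M.IsCompletable} := by
  let e := Fintype.equivFin (Σ k, Fin (n k))
  let A : (S → ℝ) × (Fin (Fintype.card (Σ k, Fin (n k))) → ℝ) → Prop := fun y =>
    (∀ k, ∑ j, y.2 (e ⟨k, j⟩) = 1) ∧ ∀ s : S, ∏ k, y.2 (e ⟨k, s.1 k⟩) = y.1 s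
  have hA : SignDefinable (fun y : (S → ℝ) × _ =>
      MvPolynomial.eval₂Hom (MvPolynomial.eval y.1) y.2) A := by
    refine (SignDefinable.forall_fintype fun k => ?_).and (SignDefinable.forall_fintype fun s => ?_)
    · refine (SignDefinable.eq_zero (∑ j, MvPolynomial.X (e ⟨k, j⟩) - 1)).congr fun y => ?_
      rw [map_sub, map_sum, map_one, sub_eq_zero]
      simp
    · refine (SignDefinable.eq_zero (∏ k, MvPolynomial.X (e ⟨k, s.1 k⟩) -
        MvPolynomial.C (MvPolynomial.X s))).congr fun y => ?_
      rw [map_sub, map_prod, sub_eq_zero]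
      simp
  refine (hA.exists_forall_mem_Icc.congr fun M => ?_).isSemialgebraic
  rw [PartialTensor.isCompletable_iff]
  constructor
  · rintro ⟨u, hu, hM⟩
    have he : ∀ k j, u (e.symm (e ⟨k, j⟩)).1 (e.symm (e ⟨k, j⟩)).2 = u k j := fun k j => by
      rw [e.symm_apply_apply]
    refine ⟨fun i => u (e.symm i).1 (e.symm i).2, fun i => ?_, fun k => ?_, fun s => ?_⟩
    -- Entries of probability vectors lie in `[0, 1]`, which is why bounded quantifiers suffice.
    · exact mem_Icc_of_mem_stdSimplex (hu _) _
    · simpa only [he] using (hu k).2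
    · simpa only [he] using hM s
  · rintro ⟨v, hv, hsum, hM⟩
    exact ⟨fun k j => v (e ⟨k, j⟩), fun k => ⟨fun j => (hv _).1, hsum k⟩, hM⟩
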